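/- Let $L_2(\exp)$ be the two-sorted language of second-order arithmetic (numbers and sets of numbers, with $0,1,+,\cdot,<,\in$) together with a binary symbol for exponentiation. The theory $\mathsf{RCA}_0^*$ has as axioms: the basic axioms of arithmetic ($n+1\neq 0$; $m+1=n+1\to m=n$; $m+0=m$; $m+(n+1)=(m+n)+1$; $m\cdot 0=0$; $m\cdot(n+1)=m\cdot n+m$; $\neg\, m<0$; $m<n+1\leftrightarrow (m<n\vee m=n)$), the exponentiation axioms $m^0=1$ and $m^{n+1}=m^n\cdot m$, induction for all $\Sigma^0_0$ formulas of $L_2(\exp)$, and $\Delta^0_1$ comprehension. Ordered pairs are coded by $(i,j)=(i+j)^2+i$, and a function is a set of pairs that contains exactly one pair $(x,y)$ for each $x$ in its domain. Then the following are equivalent over $\mathsf{RCA}_0^*$, that is, in every model of $\mathsf{RCA}_0^*$ they are either all true or all false: 1. $\mathsf{I}\Sigma^0_1$, the induction scheme for all $\Sigma^0_1$ formulas (with number and set parameters). 2. $\mathsf{ERT}$: for every $k\in\mathbb N$ and every $f:\mathbb N\to\{0,\dots,k-1\}$ there is $b\in\mathbb N$ such that for all $x\ge b$ there is $y\ge b$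 with $x\ne y$ and $f(x)=f(y)$. 3. $\forall j\,\mathsf{ERT}(j)$, where $\mathsf{ERT}(j)$ says: for every $k\in\mathbb N$ and every $f:\mathbb N\to\{0,\dots,k-1\}$ there is $b\in\mathbb N$ such that every value of $f$ that appears at or after $b$ appears at least $j$ times at or after $b$, i.e. for each $x\ge b$ there is a strictly increasing sequence $y_0<y_1<\dots<y_{j-1}$ of numbers $\ge b$ with $f(y_i)=f(x)$ for all $i<j$. -/

import Mathlib

namespace SecondOrderArith

universe u

/-- Number terms of the language `L₂(exp)`: numerical variables `x₀, x₁, …`, the constants `0`, `1`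
and the binary function symbols for addition, multiplication and exponentiation. -/
inductive Term : Type
  | var (i : ℕ)
  | zero
  | one
  | add (s t : Term)
  | mul (s t : Term)
  | exp (s t : Term)

/-- The `Σ⁰₀` formulas of `L₂(exp)`: built from the atomic formulas `s = t`, `s < t`, `t ∈ X_i` by
propositional connectives and the bounded number quantifiers `∀ x < t` and `∃ x < t`, where `x` does
not occur in `t`. Number variables are de Bruijn indices: in the scope of a quantifier the bound
variable is `var 0` and every other index is shifted by one; the bound `t` lies outside the scope.
Free number and set variables serve as parameters. -/
inductive Sigma00 : Type
  | eq (s t : Term)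
  | lt (s t : Term)
  | mem (t : Term) (i : ℕ)
  | not (φ : Sigma00)
  | and (φ ψ : Sigma00)
  | or (φ ψ : Sigma00)
  | imp (φ ψ : Sigma00)
  | ballLT (t : Term) (φ : Sigma00)
  | bexLT (t : Term) (φ : Sigma00)

/-- `push a v` is the sequence `a, v 0, v 1, …`. -/
def push {α : Type u} (a : α) (v : ℕ → α) : ℕ → α
  | 0 => a
  | n + 1 => v n

/-- Structures for `L₂(exp)`: a first-order part `Num`, over which the number variables range, and a
nonempty family `sets` of subsets of it, over which the set variables range. No axioms are imposed
on the operations and on the order. -/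
structure Model : Type (u + 1) where
  Num : Type u
  zero : Num
  one : Num
  add : Num → Num → Num
  mul : Num → Num → Num
  exp : Num → Num → Num
  lt : Num → Num → Prop
  sets : Set (Set Num)
  sets_nonempty : sets.Nonempty

namespace Model

variable (M : Model.{u})

/-- Value of a term under an assignment of the number variables. -/
def eval (v : ℕ → M.Num) : Term → M.Num
  | .var i => v i
  | .zero => M.zero
  | .one => M.one
  | .add s t => M.add (eval v s) (eval v t)
  | .mul s t => M.mul (eval v s) (eval v t)
  | .exp s t => M.exp (eval v s) (eval v t)

/-- Truth of a `Σ⁰₀` formula under an assignment `v` of the number variables and an assignment `V`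
of the set variables. -/
def Sat (V : ℕ → M.sets) : (ℕ → M.Num) → Sigma00 → Prop
  | v, .eq s t => M.eval v s = M.eval v t
  | v, .lt s t => M.lt (M.eval v s) (M.eval v t)
  | v, .mem t i => M.eval v t ∈ (V i : Set M.Num)
  | v, .not φ => ¬ Sat V v φ
  | v, .and φ ψ => Sat V v φ ∧ Sat V v ψ
  | v, .or φ ψ => Sat V v φ ∨ Sat V v ψ
  | v, .imp φ ψ => Sat V v φ → Sat V v ψ
  | v, .ballLT t φ => ∀ a, M.lt a (M.eval v t) → Sat V (push a v) φ
  | v, .bexLT t φ => ∃ a, M.lt a (M.eval v t) ∧ Sat V (push a v) φ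

/-- Truth of the `Σ⁰₁` formula `∃ x θ`. -/
def SatSigma01 (V : ℕ → M.sets) (v : ℕ → M.Num) (θ : Sigma00) : Prop :=
  ∃ a, M.Sat V (push a v) θ

/-- Truth of the `Π⁰₁` formula `∀ x θ`. -/
def SatPi01 (V : ℕ → M.sets) (v : ℕ → M.Num) (θ : Sigma00) : Prop :=
  ∀ a, M.Sat V (push a v) θ

/-- The induction axiom for the predicate `P`. -/
def Induction (P : M.Num → Prop) : Prop :=
  P M.zero → (∀ n, P n → P (M.add n M.one)) → ∀ n, P n

/-- The `Σ⁰₀` induction scheme (all parameters universally quantified). -/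
def ISigma00 : Prop :=
  ∀ (θ : Sigma00) (V : ℕ → M.sets) (v : ℕ → M.Num),
    M.Induction fun n => M.Sat V (push n v) θ

/-- The `Σ⁰₁` induction scheme (all parameters universally quantified). -/
def ISigma01 : Prop :=
  ∀ (θ : Sigma00) (V : ℕ → M.sets) (v : ℕ → M.Num),
    M.Induction fun n => M.SatSigma01 V (push n v) θ

/-- The `Δ⁰₁` (recursive) comprehension scheme: if a `Σ⁰₁` formula `φ(n)` and a `Π⁰₁` formula `ψ(n)`
are equivalent for all `n`, then the set `{n | φ(n)}` exists (all parameters universally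
quantified). -/
def Delta01Comprehension : Prop :=
  ∀ (θ η : Sigma00) (V : ℕ → M.sets) (v : ℕ → M.Num),
    (∀ n, M.SatSigma01 V (push n v) θ ↔ M.SatPi01 V (push n v) η) →
      ∃ X ∈ M.sets, ∀ n, n ∈ X ↔ M.SatSigma01 V (push n v) θ

/-- `M` is a model of `RCA₀*`: basic arithmetic, the recursion equations of exponentiation,
`Σ⁰₀` induction and `Δ⁰₁` comprehension. -/
structure RCA0Star : Prop where
  succ_ne_zero : ∀ n, M.add n M.one ≠ M.zero
  succ_inj : ∀ m n, M.add m M.one = M.add n M.one → m = n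
  add_zero : ∀ m, M.add m M.zero = m
  add_succ : ∀ m n, M.add m (M.add n M.one) = M.add (M.add m n) M.one
  mul_zero : ∀ m, M.mul m M.zero = M.zero
  mul_succ : ∀ m n, M.mul m (M.add n M.one) = M.add (M.mul m n) m
  not_lt_zero : ∀ m, ¬ M.lt m M.zero
  lt_succ : ∀ m n, M.lt m (M.add n M.one) ↔ M.lt m n ∨ m = n
  exp_zero : ∀ m, M.exp m M.zero = M.one
  exp_succ : ∀ m n, M.exp m (M.add n M.one) = M.mul (M.exp m n) m
  sigma00_induction : M.ISigma00
  delta01_comprehension : M.Delta01Comprehension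

/-- The defined relation `m ≤ n`. -/
def le (m n : M.Num) : Prop := M.lt m n ∨ m = n

/-- The standard code `(i, j) = (i + j)² + i` of an ordered pair. -/
def pair (i j : M.Num) : M.Num := M.add (M.mul (M.add i j) (M.add i j)) i

/-- The initial segment `{n | n < k}`, identified with `k` as a set of colors. -/
def below (k : M.Num) : Set M.Num := {n | M.lt n k}

/-- `F` codes a function from `X` to `Y`: it is a set of (codes of) pairs in `X × Y` that contains,
for each `x` in `X`, exactly one pair with first entry `x`. -/
def IsFun (F X Y : Set M.Num) : Prop :=
  (∀ z ∈ F, ∃ x ∈ X, ∃ y ∈ Y, z = M.pair x y) ∧ ∀ x ∈ X, ∃! y, M.pair x y ∈ F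

/-- `x` and `y` have the same value under the function coded by `F`. -/
def SameValue (F : Set M.Num) (x y : M.Num) : Prop :=
  ∃ c, M.pair x c ∈ F ∧ M.pair y c ∈ F

/-- The principle `ERT`: for every `f : ℕ → k` there is `b` such that for each `x ≥ b` there is
`y ≥ b` with `x ≠ y` and `f x = f y`. -/
def ERT : Prop :=
  ∀ k, ∀ F ∈ M.sets, M.IsFun F Set.univ (M.below k) →
    ∃ b, ∀ x, M.le b x → ∃ y, M.le b y ∧ x ≠ y ∧ M.SameValue F x y

/-- Inside `M`: the value at `x` of the function coded by `F` occurs at least `j` times at or after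
`b`, i.e. there is a sequence `y_0 < y_1 < … < y_{j-1}` (a function with domain `{i | i < j}` that
belongs to `M`) of arguments `≥ b` at which the function has the same value as at `x`. -/
def OccursAtLeast (F : Set M.Num) (b x j : M.Num) : Prop :=
  ∃ G ∈ M.sets, M.IsFun G (M.below j) Set.univ ∧
    (∀ i i' y y', M.lt i i' → M.pair i y ∈ G → M.pair i' y' ∈ G → M.lt y y') ∧
    ∀ i y, M.pair i y ∈ G → M.le b y ∧ M.SameValue F x y

/-- The principle `ERT(j)`: for every `f : ℕ → k` there is `b` such that each value of `f` that
appears at or after `b` appears at least `j` times at or after `b`. -/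
def ERTAt (j : M.Num) : Prop :=
  ∀ k, ∀ F ∈ M.sets, M.IsFun F Set.univ (M.below k) →
    ∃ b, ∀ x, M.le b x → M.OccursAtLeast F b x j

end Model

end SecondOrderArith

/-!
`IΣ⁰₁` implies `ERT(j)`. A maximality argument gives strong `Σ⁰₁` collection: below any bound, all
the numbers that have a witness at all have one below some `t`. Count the occurrences of each color
before `s` and reduce modulo `j`; by collection there is a `t₀` such that each vector of residues
which is attained is attained before `t₀`. Let `t ≥ t₀` be so large that every color which occurs at
or after `t₀` does so before `t`. Some `b < t₀` has the same vector as `t`, so the number of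
occurrences in `[b, t)` of each color is a multiple of `j`, and it is positive for the colors which
occur at or after `b`.

`ERT` implies `IΣ⁰₁`. Suppose that the inductive property `∃ x, T n x` fails at `n = a`. The least
`n ≤ a` without a witness below `s` is nondecreasing in `s`. Color `s` by this value if the value
changes from `s` to `s + 1`, and by `a + 1` otherwise. Colors other than `a + 1` do not repeat, so
by `ERT` the value is eventually constant. The constant has no witness at all, although `0` has
one and every smaller number has one, contradicting that the property is inductive.
-/

namespace SecondOrderArith

namespace Model

universe u

open Filter

variable {M : Model.{u}}

section Definability

variable {n m : ℕ}

/-- Functions given by terms of `L₂(exp)` with number parameters. -/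
inductive IsTerm (M : Model.{u}) : ∀ {n : ℕ}, ((Fin n → M.Num) → M.Num) → Prop
  | const {n : ℕ} (a : M.Num) : IsTerm M fun _ : Fin n → M.Num => a
  | var {n : ℕ} (i : Fin n) : IsTerm M fun x => x i
  | add {n : ℕ} {s t : (Fin n → M.Num) → M.Num} :
      IsTerm M s → IsTerm M t → IsTerm M fun x => M.add (s x) (t x)
  | mul {n : ℕ} {s t : (Fin n → M.Num) → M.Num} :
      IsTerm M s → IsTerm M t → IsTerm M fun x => M.mul (s x) (t x)
  | exp {n : ℕ} {s t : (Fin n → M.Num) → M.Num} :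
      IsTerm M s → IsTerm M t → IsTerm M fun x => M.exp (s x) (t x)

/-- Relations defined by `Σ⁰₀` formulas with number and set parameters. The closure properties are
the constructors, so that definability goals are solved by `constructor`; `exists_formula` recovers
a formula. -/
inductive Definable (M : Model.{u}) : ∀ {n : ℕ}, ((Fin n → M.Num) → Prop) → Prop
  | eq {n : ℕ} {s t : (Fin n → M.Num) → M.Num} :
      IsTerm M s → IsTerm M t → Definable M fun x => s x = t x
  | lt {n : ℕ} {s t : (Fin n → M.Num) → M.Num} :
      IsTerm M s → IsTerm M t → Definable M fun x => M.lt (s x) (t x)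
  | mem {n : ℕ} {t : (Fin n → M.Num) → M.Num} {X : Set M.Num} :
      X ∈ M.sets → IsTerm M t → Definable M fun x => t x ∈ X
  | not {n : ℕ} {P : (Fin n → M.Num) → Prop} : Definable M P → Definable M fun x => ¬ P x
  | and {n : ℕ} {P Q : (Fin n → M.Num) → Prop} :
      Definable M P → Definable M Q → Definable M fun x => P x ∧ Q x
  | or {n : ℕ} {P Q : (Fin n → M.Num) → Prop} :
      Definable M P → Definable M Q → Definable M fun x => P x ∨ Q x
  | ball {n : ℕ} {t : (Fin n → M.Num) → M.Num} {P : M.Num → (Fin n → M.Num) → Prop} :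
      IsTerm M t → Definable M (fun y : Fin (n + 1) → M.Num => P (y 0) (Fin.tail y)) →
      Definable M fun x => ∀ a, M.lt a (t x) → P a x
  | bex {n : ℕ} {t : (Fin n → M.Num) → M.Num} {P : M.Num → (Fin n → M.Num) → Prop} :
      IsTerm M t → Definable M (fun y : Fin (n + 1) → M.Num => P (y 0) (Fin.tail y)) →
      Definable M fun x => ∃ a, M.lt a (t x) ∧ P a x
  | imp {n : ℕ} {P Q : (Fin n → M.Num) → Prop} :
      Definable M P → Definable M Q → Definable M fun x => P x → Q x

/-- `Definable` for a unary predicate in curried form. -/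
abbrev Definable₁ (P : M.Num → Prop) : Prop :=
  Definable M fun x : Fin 1 → M.Num => P (x 0)

/-- `Definable` for a binary relation in curried form. -/
abbrev Definable₂ (R : M.Num → M.Num → Prop) : Prop :=
  Definable M fun x : Fin 2 → M.Num => R (x 0) (x 1)

/-- `Definable` for a ternary relation in curried form. -/
abbrev Definable₃ (R : M.Num → M.Num → M.Num → Prop) : Prop :=
  Definable M fun x : Fin 3 → M.Num => R (x 0) (x 1) (x 2)

/-- `Definable` for a quaternary relation in curried form. -/
abbrev Definable₄ (R : M.Num → M.Num → M.Num → M.Num → Prop) : Prop :=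
  Definable M fun x : Fin 4 → M.Num => R (x 0) (x 1) (x 2) (x 3)

/-- Functions with a `Σ⁰₀` definable graph. -/
abbrev DefinableFun (f : M.Num → M.Num) : Prop :=
  Definable₂ fun x y => f x = y

theorem IsTerm.subst {t : (Fin n → M.Num) → M.Num} (ht : IsTerm M t)
    {s : (Fin m → M.Num) → Fin n → M.Num} (hs : ∀ i, IsTerm M fun y => s y i) :
    IsTerm M fun y => t (s y) := by
  induction ht with
  | const a => exact .const a
  | var i => exact hs i
  | add _ _ h₁ h₂ => exact .add h₁ h₂
  | mul _ _ h₁ h₂ => exact .mul h₁ h₂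
  | exp _ _ h₁ h₂ => exact .exp h₁ h₂

theorem IsTerm.tail {t : (Fin n → M.Num) → M.Num} (ht : IsTerm M t) :
    IsTerm M fun y : Fin (n + 1) → M.Num => t (Fin.tail y) :=
  ht.subst fun i => .var i.succ

theorem IsTerm.cons_tail {s : (Fin m → M.Num) → Fin n → M.Num}
    (hs : ∀ i, IsTerm M fun y => s y i) (i : Fin (n + 1)) :
    IsTerm M fun y : Fin (m + 1) → M.Num =>
      (Fin.cons (y 0) (s (Fin.tail y)) : Fin (n + 1) → M.Num) i := by
  cases i using Fin.cases with
  | zero => exact .var 0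
  | succ i => exact (hs i).tail

theorem Definable.subst {P : (Fin n → M.Num) → Prop} (hP : Definable M P)
    {s : (Fin m → M.Num) → Fin n → M.Num} (hs : ∀ i, IsTerm M fun y => s y i) :
    Definable M fun y => P (s y) := by
  induction hP generalizing m with
  | eq h₁ h₂ => exact .eq (h₁.subst hs) (h₂.subst hs)
  | lt h₁ h₂ => exact .lt (h₁.subst hs) (h₂.subst hs)
  | mem hX h => exact .mem hX (h.subst hs)
  | not _ h => exact .not (h hs)
  | and _ _ h₁ h₂ => exact .and (h₁ hs) (h₂ hs)
  | or _ _ h₁ h₂ => exact .or (h₁ hs) (h₂ hs)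
  | imp _ _ h₁ h₂ => exact .imp (h₁ hs) (h₂ hs)
  | ball ht _ h => exact .ball (ht.subst hs) (h (IsTerm.cons_tail hs))
  | bex ht _ h => exact .bex (ht.subst hs) (h (IsTerm.cons_tail hs))

theorem Definable₁.comp {P : M.Num → Prop} (hP : Definable₁ P) {t : (Fin n → M.Num) → M.Num}
    (ht : IsTerm M t) : Definable M fun x => P (t x) :=
  hP.subst (s := fun x => ![t x]) (Fin.forall_fin_one.2 ht)

theorem Definable₂.comp {R : M.Num → M.Num → Prop} (hR : Definable₂ R)
    {s t : (Fin n → M.Num) → M.Num} (hs : IsTerm M s) (ht : IsTerm M t) :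
    Definable M fun x => R (s x) (t x) :=
  hR.subst (s := fun x => ![s x, t x]) (Fin.forall_fin_two.2 ⟨hs, ht⟩)

theorem Definable₃.comp {R : M.Num → M.Num → M.Num → Prop} (hR : Definable₃ R)
    {r s t : (Fin n → M.Num) → M.Num} (hr : IsTerm M r) (hs : IsTerm M s) (ht : IsTerm M t) :
    Definable M fun x => R (r x) (s x) (t x) :=
  hR.subst (s := fun x => ![r x, s x, t x]) (Fin.forall_fin_succ.2
    ⟨hr, Fin.forall_fin_two.2 ⟨hs, ht⟩⟩)

theorem Definable₄.comp {R : M.Num → M.Num → M.Num → M.Num → Prop} (hR : Definable₄ R)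
    {q r s t : (Fin n → M.Num) → M.Num} (hq : IsTerm M q) (hr : IsTerm M r) (hs : IsTerm M s)
    (ht : IsTerm M t) : Definable M fun x => R (q x) (r x) (s x) (t x) :=
  hR.subst (s := fun x => ![q x, r x, s x, t x]) (Fin.forall_fin_succ.2
    ⟨hq, Fin.forall_fin_succ.2 ⟨hr, Fin.forall_fin_two.2 ⟨hs, ht⟩⟩⟩)

theorem IsTerm.eval {v : (Fin n → M.Num) → ℕ → M.Num} (hv : ∀ i, IsTerm M fun x => v x i)
    (τ : Term) : IsTerm M fun x => M.eval (v x) τ := by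
  induction τ with
  | var i => exact hv i
  | zero => exact .const M.zero
  | one => exact .const M.one
  | add _ _ h₁ h₂ => exact .add h₁ h₂
  | mul _ _ h₁ h₂ => exact .mul h₁ h₂
  | exp _ _ h₁ h₂ => exact .exp h₁ h₂

theorem IsTerm.push_tail {v : (Fin n → M.Num) → ℕ → M.Num} (hv : ∀ i, IsTerm M fun x => v x i)
    (i : ℕ) : IsTerm M fun y : Fin (n + 1) → M.Num => push (y 0) (v (Fin.tail y)) i := by
  cases i with
  | zero => exact .var 0
  | succ i => exact (hv i).tail

theorem Definable.sat (V : ℕ → M.sets) (θ : Sigma00) {v : (Fin n → M.Num) → ℕ → M.Num}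
    (hv : ∀ i, IsTerm M fun x => v x i) : Definable M fun x => M.Sat V (v x) θ := by
  induction θ generalizing n with
  | eq s t => exact .eq (.eval hv s) (.eval hv t)
  | lt s t => exact .lt (.eval hv s) (.eval hv t)
  | mem t i => exact .mem (V i).2 (.eval hv t)
  | not _ h => exact .not (h hv)
  | and _ _ h₁ h₂ => exact .and (h₁ hv) (h₂ hv)
  | or _ _ h₁ h₂ => exact .or (h₁ hv) (h₂ hv)
  | imp _ _ h₁ h₂ => exact .imp (h₁ hv) (h₂ hv)
  | ballLT t _ h => exact .ball (.eval hv t) (h (IsTerm.push_tail hv))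
  | bexLT t _ h => exact .bex (.eval hv t) (h (IsTerm.push_tail hv))

theorem definable₂_sat (V : ℕ → M.sets) (v : ℕ → M.Num) (θ : Sigma00) :
    Definable₂ fun n a => M.Sat V (push a (push n v)) θ :=
  .sat V θ fun
    | 0 => .var 1
    | 1 => .var 0
    | i + 2 => .const (v i)

/-- The assignment with values `x 0, …, x (n - 1), v 0, v 1, …`. -/
def prepend {α : Type u} : ∀ {n : ℕ}, (Fin n → α) → (ℕ → α) → ℕ → α
  | 0, _, v => v
  | _ + 1, x, v => push (x 0) (prepend (Fin.tail x) v)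

theorem prepend_val {α : Type u} (x : Fin n → α) (v : ℕ → α) (i : Fin n) :
    prepend x v i = x i := by
  induction n with
  | zero => exact i.elim0
  | succ n ih => exact Fin.cases rfl (fun i => ih (Fin.tail x) i) i

theorem prepend_add {α : Type u} (x : Fin n → α) (v : ℕ → α) (i : ℕ) :
    prepend x v (i + n) = v i := by
  induction n with
  | zero => rfl
  | succ n ih => exact ih (Fin.tail x)

/-- The filter on sequences in `α` generated by the conditions that a given element occurs. Finitely
many parameters from `α` are values of `enumerating α`-almost every assignment, so a formula with
parameters need not be accompanied by a list of them. -/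
def enumerating (α : Type u) : Filter (ℕ → α) :=
  ⨅ A : Finset α, 𝓟 {v | ↑A ⊆ Set.range v}

instance enumerating_neBot (α : Type u) [Nonempty α] : (enumerating α).NeBot := by
  classical
  refine iInf_neBot_of_directed (fun A B => ⟨A ∪ B, ?_, ?_⟩) fun A => principal_neBot_iff.2 ?_
  · exact principal_mono.2 fun v hv => (Finset.coe_subset.2 Finset.subset_union_left).trans hv
  · exact principal_mono.2 fun v hv => (Finset.coe_subset.2 Finset.subset_union_right).trans hv
  · obtain ⟨v, hv⟩ := (A.countable_toSet.insert (Classical.arbitrary α)).exists_eq_range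
      (Set.insert_nonempty _ _)
    exact ⟨v, (Set.subset_insert _ _).trans hv.subset⟩

theorem eventually_enumerating {α : Type u} (a : α) : ∀ᶠ v in enumerating α, ∃ i, v i = a :=
  mem_iInf_of_mem {a} fun _ hv => hv (Finset.mem_coe.2 (Finset.mem_singleton_self a))

theorem IsTerm.eventually_exists_term {t : (Fin n → M.Num) → M.Num} (ht : IsTerm M t) :
    ∀ᶠ v in enumerating M.Num, ∃ τ : Term, ∀ x, M.eval (prepend x v) τ = t x := by
  induction ht with
  | const a =>
    filter_upwards [eventually_enumerating a] with v ⟨i, hi⟩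
    exact ⟨.var (i + n), fun x => (prepend_add x v i).trans hi⟩
  | var i => exact .of_forall fun v => ⟨.var i, fun x => prepend_val x v i⟩
  | add _ _ h₁ h₂ =>
    filter_upwards [h₁, h₂] with v ⟨σ, hσ⟩ ⟨τ, hτ⟩
    exact ⟨.add σ τ, fun x => by simp only [Model.eval, hσ, hτ]⟩
  | mul _ _ h₁ h₂ =>
    filter_upwards [h₁, h₂] with v ⟨σ, hσ⟩ ⟨τ, hτ⟩
    exact ⟨.mul σ τ, fun x => by simp only [Model.eval, hσ, hτ]⟩
  | exp _ _ h₁ h₂ =>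
    filter_upwards [h₁, h₂] with v ⟨σ, hσ⟩ ⟨τ, hτ⟩
    exact ⟨.exp σ τ, fun x => by simp only [Model.eval, hσ, hτ]⟩

theorem Definable.eventually_exists_formula {P : (Fin n → M.Num) → Prop} (hP : Definable M P) :
    ∀ᶠ p in enumerating M.Num ×ˢ enumerating M.sets,
      ∃ θ : Sigma00, ∀ x, M.Sat p.2 (prepend x p.1) θ ↔ P x := by
  induction hP with
  | eq h₁ h₂ =>
    filter_upwards [h₁.eventually_exists_term.prod_inl _, h₂.eventually_exists_term.prod_inl _]
      with p ⟨σ, hσ⟩ ⟨τ, hτ⟩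
    exact ⟨.eq σ τ, fun x => by simp only [Sat, hσ, hτ]⟩
  | lt h₁ h₂ =>
    filter_upwards [h₁.eventually_exists_term.prod_inl _, h₂.eventually_exists_term.prod_inl _]
      with p ⟨σ, hσ⟩ ⟨τ, hτ⟩
    exact ⟨.lt σ τ, fun x => by simp only [Sat, hσ, hτ]⟩
  | @mem _ _ X hX h =>
    filter_upwards [h.eventually_exists_term.prod_inl _,
      (eventually_enumerating (⟨X, hX⟩ : M.sets)).prod_inr _] with p ⟨τ, hτ⟩ ⟨i, hi⟩
    exact ⟨.mem τ i, fun x => by simp only [Sat, hτ, hi]⟩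
  | not _ h =>
    filter_upwards [h] with p ⟨θ, hθ⟩
    exact ⟨.not θ, fun x => by simp only [Sat, hθ]⟩
  | and _ _ h₁ h₂ =>
    filter_upwards [h₁, h₂] with p ⟨θ, hθ⟩ ⟨η, hη⟩
    exact ⟨.and θ η, fun x => by simp only [Sat, hθ, hη]⟩
  | or _ _ h₁ h₂ =>
    filter_upwards [h₁, h₂] with p ⟨θ, hθ⟩ ⟨η, hη⟩
    exact ⟨.or θ η, fun x => by simp only [Sat, hθ, hη]⟩
  | imp _ _ h₁ h₂ =>
    filter_upwards [h₁, h₂] with p ⟨θ, hθ⟩ ⟨η, hη⟩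
    exact ⟨.imp θ η, fun x => by simp only [Sat, hθ, hη]⟩
  | ball ht _ h =>
    filter_upwards [ht.eventually_exists_term.prod_inl _, h] with p ⟨τ, hτ⟩ ⟨θ, hθ⟩
    refine ⟨.ballLT τ θ, fun x => ?_⟩
    simp only [Sat, hτ]
    exact forall₂_congr fun a _ => hθ (Fin.cons a x)
  | bex ht _ h =>
    filter_upwards [ht.eventually_exists_term.prod_inl _, h] with p ⟨τ, hτ⟩ ⟨θ, hθ⟩
    refine ⟨.bexLT τ θ, fun x => ?_⟩
    simp only [Sat, hτ]
    exact exists_congr fun a => and_congr_right fun _ => hθ (Fin.cons a x)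

theorem Definable.exists_formula {P : (Fin n → M.Num) → Prop} (hP : Definable M P) :
    ∃ (θ : Sigma00) (V : ℕ → M.sets) (v : ℕ → M.Num), ∀ x, M.Sat V (prepend x v) θ ↔ P x := by
  have : Nonempty M.Num := ⟨M.zero⟩
  have : Nonempty M.sets := M.sets_nonempty.to_subtype
  obtain ⟨⟨v, V⟩, θ, hθ⟩ := hP.eventually_exists_formula.exists
  exact ⟨θ, V, v, hθ⟩

end Definability

section Induction

theorem ISigma01.induction (hI : M.ISigma01) {R : M.Num → M.Num → Prop} (definable : Definable₂ R)
    (zero : ∃ a, R M.zero a) (succ : ∀ n, (∃ a, R n a) → ∃ a, R (M.add n M.one) a) (n : M.Num) :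
    ∃ a, R n a := by
  have hR : Definable₂ fun a n => R n a := definable.comp (.var 1) (.var 0)
  obtain ⟨θ, V, v, hθ⟩ := hR.exists_formula
  have hsat (n) : M.SatSigma01 V (push n v) θ ↔ ∃ a, R n a := exists_congr fun a => hθ ![a, n]
  have hind := hI θ V v
  simp only [Model.Induction, hsat] at hind
  exact hind zero succ n

variable [hM : Fact M.RCA0Star]

theorem induction_of_definable₁ {P : M.Num → Prop} (hP : Definable₁ P) : M.Induction P := by
  obtain ⟨θ, V, v, hθ⟩ := hP.exists_formula
  have hsat (n) : M.Sat V (push n v) θ ↔ P n := hθ fun _ => n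
  have hind := hM.out.sigma00_induction θ V v
  simpa only [hsat] using hind

theorem ofPred_mem_sets {P : M.Num → Prop} (hP : Definable₁ P) : {n | P n} ∈ M.sets := by
  have hP' : Definable₂ fun _ n : M.Num => P n := hP.comp (.var 1)
  obtain ⟨θ, V, v, hθ⟩ := hP'.exists_formula
  have hsat (a n) : M.Sat V (push a (push n v)) θ ↔ P n := hθ ![a, n]
  have hsigma (n) : M.SatSigma01 V (push n v) θ ↔ P n :=
    ⟨fun ⟨a, h⟩ => (hsat a n).1 h, fun h => ⟨n, (hsat n n).2 h⟩⟩
  have hpi (n) : M.SatPi01 V (push n v) θ ↔ P n :=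
    ⟨fun h => (hsat n n).1 (h n), fun h a => (hsat a n).2 h⟩
  obtain ⟨X, hX, hXP⟩ := hM.out.delta01_comprehension θ θ V v fun n =>
    (hsigma n).trans (hpi n).symm
  have : {n | P n} = X := Set.ext fun n => ((hXP n).trans (hsigma n)).symm
  exact this ▸ hX

end Induction

section Arithmetic

instance : Zero M.Num := ⟨M.zero⟩

instance : One M.Num := ⟨M.one⟩

instance : Add M.Num := ⟨M.add⟩

instance : Mul M.Num := ⟨M.mul⟩

instance : Pow M.Num M.Num := ⟨M.exp⟩

instance : LT M.Num := ⟨M.lt⟩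

instance : LE M.Num := ⟨M.le⟩

theorem pair_def (i j : M.Num) : M.pair i j = (i + j) * (i + j) + i := rfl

variable [hM : Fact M.RCA0Star]

@[elab_as_elim]
theorem definable_induction {P : M.Num → Prop} (definable : Definable₁ P) (zero : P 0)
    (succ : ∀ n, P n → P (n + 1)) (n : M.Num) : P n :=
  induction_of_definable₁ definable zero succ n

protected theorem add_zero (m : M.Num) : m + 0 = m := hM.out.add_zero m

protected theorem add_add_one (m n : M.Num) : m + (n + 1) = m + n + 1 := hM.out.add_succ m n

protected theorem zero_add (n : M.Num) : 0 + n = n := by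
  induction n using definable_induction with
  | definable => repeat' constructor
  | zero => exact Model.add_zero 0
  | succ n ih => rw [Model.add_add_one, ih]

protected theorem add_one_add (m n : M.Num) : m + 1 + n = m + n + 1 := by
  induction n using definable_induction with
  | definable => repeat' constructor
  | zero => rw [Model.add_zero, Model.add_zero]
  | succ n ih => rw [Model.add_add_one, ih, Model.add_add_one]

instance : AddCommMonoid M.Num where
  nsmul := nsmulRec
  zero_add := Model.zero_add
  add_zero := Model.add_zero
  add_assoc m n k := by
    induction k using definable_induction with
    | definable => repeat' constructor
    | zero => rw [Model.add_zero, Model.add_zero]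
    | succ k ih => rw [Model.add_add_one, ih, Model.add_add_one, Model.add_add_one]
  add_comm m n := by
    induction n using definable_induction with
    | definable => repeat' constructor
    | zero => rw [Model.add_zero, Model.zero_add]
    | succ n ih => rw [Model.add_add_one, ih, Model.add_one_add]

protected theorem mul_zero (m : M.Num) : m * 0 = 0 := hM.out.mul_zero m

protected theorem mul_add_one (m n : M.Num) : m * (n + 1) = m * n + m := hM.out.mul_succ m n

protected theorem mul_comm (m n : M.Num) : m * n = n * m := by
  have zero_mul (n : M.Num) : 0 * n = 0 := by
    induction n using definable_induction with
    | definable => repeat' constructor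
    | zero => exact Model.mul_zero 0
    | succ n ih => rw [Model.mul_add_one, ih, add_zero]
  have add_one_mul (m n : M.Num) : (m + 1) * n = m * n + n := by
    induction n using definable_induction with
    | definable => repeat' constructor
    | zero => rw [Model.mul_zero, Model.mul_zero, add_zero]
    | succ n ih => rw [Model.mul_add_one, ih, Model.mul_add_one]; abel
  induction n using definable_induction with
  | definable => repeat' constructor
  | zero => rw [Model.mul_zero, zero_mul]
  | succ n ih => rw [Model.mul_add_one, ih, add_one_mul]

protected theorem mul_add (m n k : M.Num) : m * (n + k) = m * n + m * k := by
  induction k using definable_induction with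
  | definable => repeat' constructor
  | zero => rw [Model.mul_zero, add_zero, add_zero]
  | succ k ih => rw [← add_assoc, Model.mul_add_one, ih, Model.mul_add_one, add_assoc]

protected theorem mul_one (m : M.Num) : m * 1 = m := by
  rw [← zero_add 1, Model.mul_add_one, Model.mul_zero, zero_add]

instance : CommSemiring M.Num where
  left_distrib := Model.mul_add
  right_distrib m n k := by simp only [Model.mul_comm _ k, Model.mul_add]
  zero_mul n := by rw [Model.mul_comm, Model.mul_zero]
  mul_zero := Model.mul_zero
  mul_assoc m n k := by
    induction k using definable_induction with
    | definable => repeat' constructor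
    | zero => rw [Model.mul_zero, Model.mul_zero, Model.mul_zero]
    | succ k ih => rw [Model.mul_add_one, ih, Model.mul_add_one, Model.mul_add]
  one_mul m := by rw [Model.mul_comm, Model.mul_one]
  mul_one := Model.mul_one
  mul_comm := Model.mul_comm

protected theorem not_lt_zero (m : M.Num) : ¬ m < 0 := hM.out.not_lt_zero m

protected theorem lt_add_one_iff {m n : M.Num} : m < n + 1 ↔ m ≤ n := hM.out.lt_succ m n

protected theorem lt_add_one (n : M.Num) : n < n + 1 := Model.lt_add_one_iff.2 (.inr rfl)

protected theorem lt_trans {a b c : M.Num} (hab : a < b) (hbc : b < c) : a < c := by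
  induction c using definable_induction with
  | definable => repeat' constructor
  | zero => exact absurd hbc (Model.not_lt_zero b)
  | succ c ih =>
    rcases Model.lt_add_one_iff.1 hbc with hbc | rfl
    · exact Model.lt_add_one_iff.2 (.inl (ih hbc))
    · exact Model.lt_add_one_iff.2 (.inl hab)

protected theorem lt_irrefl (n : M.Num) : ¬ n < n := by
  induction n using definable_induction with
  | definable => repeat' constructor
  | zero => exact Model.not_lt_zero 0
  | succ n ih =>
    intro hn
    rcases Model.lt_add_one_iff.1 hn with hn | hn
    · exact ih (Model.lt_trans (Model.lt_add_one n) hn)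
    · exact ih (by simpa only [hn] using Model.lt_add_one n)

protected theorem zero_le (n : M.Num) : 0 ≤ n := by
  induction n using definable_induction with
  | definable => repeat' constructor
  | zero => exact .inr rfl
  | succ n ih => exact .inl (Model.lt_add_one_iff.2 ih)

protected theorem add_one_lt_add_one {a b : M.Num} (h : a < b) : a + 1 < b + 1 := by
  induction b using definable_induction with
  | definable => repeat' constructor
  | zero => exact absurd h (Model.not_lt_zero a)
  | succ b ih =>
    rcases Model.lt_add_one_iff.1 h with h | rfl
    · exact Model.lt_add_one_iff.2 (.inl (ih h))
    · exact Model.lt_add_one _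

protected theorem lt_trichotomy (a b : M.Num) : a < b ∨ a = b ∨ b < a := by
  induction a using definable_induction with
  | definable => repeat' constructor
  | zero => exact (Model.zero_le b).imp_right .inl
  | succ a ih =>
    rcases ih with h | rfl | h
    · exact (Model.lt_add_one_iff.1 (Model.add_one_lt_add_one h)).imp_right .inl
    · exact .inr (.inr (Model.lt_add_one a))
    · exact .inr (.inr (Model.lt_add_one_iff.2 (.inl h)))

noncomputable instance : LinearOrder M.Num where
  le_refl _ := .inr rfl
  le_trans a b c := by
    rintro (hab | rfl) (hbc | rfl)
    exacts [.inl (Model.lt_trans hab hbc), .inl hab, .inl hbc, .inr rfl]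
  lt_iff_le_not_ge a b := by
    refine ⟨fun hab => ⟨.inl hab, ?_⟩, fun ⟨hab, hba⟩ => hab.resolve_right ?_⟩
    · rintro (hba | rfl)
      exacts [Model.lt_irrefl a (Model.lt_trans hab hba), Model.lt_irrefl _ hab]
    · rintro rfl
      exact hba (.inr rfl)
  le_antisymm a b hab hba := by
    rcases hab with hab | rfl
    · exact (hba.resolve_left fun hba => Model.lt_irrefl a (Model.lt_trans hab hba)).symm
    · rfl
  le_total a b := by
    rcases Model.lt_trichotomy a b with h | rfl | h
    exacts [.inl (.inl h), .inl (.inr rfl), .inr (.inl h)]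
  toDecidableLE := Classical.decRel _

protected theorem add_lt_add_right {a b : M.Num} (h : a < b) (c : M.Num) : a + c < b + c := by
  induction c using definable_induction with
  | definable => repeat' constructor
  | zero => rwa [add_zero, add_zero]
  | succ c ih => simpa only [← add_assoc] using Model.add_one_lt_add_one ih

protected theorem exists_eq_add_of_lt {a b : M.Num} (h : a < b) : ∃ c < b + 1, b = a + c := by
  induction b using definable_induction with
  | definable => repeat' constructor
  | zero => exact absurd h (Model.not_lt_zero a)
  | succ b ih =>
    rcases Model.lt_add_one_iff.1 h with h | rfl
    · obtain ⟨c, hc, h⟩ := ih h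
      exact ⟨c + 1, Model.add_one_lt_add_one hc, by rw [← add_assoc, ← h]⟩
    · have : 0 + 1 < a + 1 + 1 :=
        Model.add_one_lt_add_one (Model.lt_add_one_iff.2 (Model.zero_le a))
      exact ⟨1, by rwa [zero_add] at this, rfl⟩

protected theorem le_self_add (a c : M.Num) : a ≤ a + c := by
  rcases Model.zero_le c with h | rfl
  · simpa only [zero_add, add_comm c] using (Model.add_lt_add_right h a).le
  · rw [add_zero]

instance : CanonicallyOrderedAdd M.Num where
  exists_add_of_le := by
    rintro a b (h | rfl)
    · obtain ⟨c, -, hc⟩ := Model.exists_eq_add_of_lt h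
      exact ⟨c, hc⟩
    · exact ⟨0, (add_zero a).symm⟩
  le_self_add := Model.le_self_add
  le_add_self a b := (Model.le_self_add a b).trans_eq (add_comm a b)

instance : IsOrderedCancelAddMonoid M.Num where
  add_le_add_left := by
    rintro a b (h | rfl) c
    exacts [.inl (Model.add_lt_add_right h c), le_rfl]
  le_of_add_le_add_left a b c h := by
    contrapose! h
    simpa only [add_comm a] using Model.add_lt_add_right h a

noncomputable instance : SuccOrder M.Num :=
  .ofSuccLeIff (· + 1) fun {a b} => by
    refine ⟨fun h => (Model.lt_add_one a).trans_le h, fun h => ?_⟩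
    exact Model.lt_add_one_iff.1 (Model.add_one_lt_add_one h)

noncomputable instance : SuccAddOrder M.Num := ⟨fun _ => rfl⟩

instance : IsStrictOrderedRing M.Num :=
  have mul_lt_mul_left {a b c : M.Num} (hc : 0 < c) (h : a < b) : c * a < c * b := by
    obtain ⟨d, rfl⟩ := exists_add_of_le (Order.add_one_le_of_lt h)
    rw [mul_add, mul_add_one, add_assoc]
    exact lt_add_of_pos_right _ (add_pos_of_pos_of_nonneg hc (zero_le))
  { zero_le_one := zero_le
    exists_pair_ne := ⟨0 + 1, 0, hM.out.succ_ne_zero _⟩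
    mul_lt_mul_of_pos_left := fun _ hc _ _ h => mul_lt_mul_left hc h
    mul_lt_mul_of_pos_right := fun c hc a b h => by
      simpa only [mul_comm _ c] using mul_lt_mul_left hc h }

theorem exp_zero (a : M.Num) : a ^ (0 : M.Num) = 1 := hM.out.exp_zero a

theorem exp_add_one (a n : M.Num) : a ^ (n + 1) = a ^ n * a := hM.out.exp_succ a n

theorem exp_add (a m n : M.Num) : a ^ (m + n) = a ^ m * a ^ n := by
  induction n using definable_induction with
  | definable => repeat' constructor
  | zero => rw [exp_zero, add_zero, mul_one]
  | succ n ih => rw [← add_assoc, exp_add_one, ih, exp_add_one, mul_assoc]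

theorem exp_pos {a : M.Num} (ha : 0 < a) (n : M.Num) : 0 < a ^ n := by
  induction n using definable_induction with
  | definable => repeat' constructor
  | zero => rw [exp_zero]; exact one_pos
  | succ n ih => rw [exp_add_one]; exact mul_pos ih ha

theorem exists_least {P : M.Num → Prop} (hP : Definable₁ P) (h : ∃ n, P n) :
    ∃ n, P n ∧ ∀ m < n, ¬ P m := by
  by_contra! hne
  have hnot (n : M.Num) : ∀ m < n, ¬ P m := by
    induction n using definable_induction with
    | definable => exact .ball (.var 0) (.not (hP.comp (.var 0)))
    | zero => exact fun m hm => absurd hm not_lt_zero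
    | succ n ih =>
      intro m hm hPm
      obtain ⟨l, hl, hPl⟩ := hne m hPm
      exact ih l (hl.trans_le (Order.lt_add_one_iff.1 hm)) hPl
  obtain ⟨n, hn⟩ := h
  exact hnot (n + 1) n (lt_add_one n) hn

theorem pair_lt_of_add_lt {i j i' j' : M.Num} (h : i + j < i' + j') :
    M.pair i j < M.pair i' j' := by
  rw [pair_def, pair_def]
  have hsq : (i + j + 1) * (i + j + 1) ≤ (i' + j') * (i' + j') :=
    mul_le_mul' (Order.add_one_le_of_lt h) (Order.add_one_le_of_lt h)
  calc (i + j) * (i + j) + i < (i + j) * (i + j) + i + (i + 2 * j + 1) :=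
        lt_add_of_pos_right _ (by positivity)
    _ = (i + j + 1) * (i + j + 1) := by ring
    _ ≤ (i' + j') * (i' + j') := hsq
    _ ≤ (i' + j') * (i' + j') + i' := le_self_add

theorem pair_inj {i j i' j' : M.Num} : M.pair i j = M.pair i' j' ↔ i = i' ∧ j = j' := by
  refine ⟨fun h => ?_, fun ⟨hi, hj⟩ => by rw [hi, hj]⟩
  rcases lt_trichotomy (i + j) (i' + j') with hlt | heq | hgt
  · exact absurd h (pair_lt_of_add_lt hlt).ne
  · rw [pair_def, pair_def, heq] at h
    obtain rfl := add_left_cancel h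
    exact ⟨rfl, add_left_cancel heq⟩
  · exact absurd h (pair_lt_of_add_lt hgt).ne'

theorem left_le_pair (i j : M.Num) : i ≤ M.pair i j := le_add_self

theorem right_le_pair (i j : M.Num) : j ≤ M.pair i j := by
  calc j ≤ i + j := le_add_self
    _ ≤ (i + j) * (i + j) := by
      rcases eq_or_ne (i + j) 0 with h | h
      · rw [h, mul_zero]
      · exact le_mul_of_one_le_left' (Order.one_le_iff_pos.2 (pos_iff_ne_zero.2 h))
    _ ≤ M.pair i j := le_self_add

end Arithmetic

section DefinableFun

theorem Definable.congr {n : ℕ} {P Q : (Fin n → M.Num) → Prop} (hP : Definable M P)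
    (h : ∀ x, P x ↔ Q x) : Definable M Q :=
  funext (fun x => propext (h x)) ▸ hP

variable [hM : Fact M.RCA0Star] {f : M.Num → M.Num}

theorem exists_definableFun_least {R : M.Num → M.Num → Prop} (hR : Definable₂ R)
    (h : ∀ x, ∃ y, R x y) :
    ∃ f, DefinableFun f ∧ (∀ x, R x (f x)) ∧ ∀ x y, R x y → f x ≤ y := by
  have hleast (x) := exists_least (hR.comp (.const x) (.var 0)) (h x)
  choose f hf hmin using hleast
  refine ⟨f, ?_, hf, fun x y hxy => not_lt.1 fun hlt => hmin x y hlt hxy⟩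
  refine Definable.congr (P := fun x => R (x 0) (x 1) ∧ ∀ z < x 1, ¬ R (x 0) z) ?_ fun x => ?_
  · repeat' first | apply hR.comp | constructor
  · refine ⟨fun ⟨hR, hz⟩ => ?_, fun h => h ▸ ⟨hf _, hmin _⟩⟩
    exact le_antisymm (not_lt.1 fun hlt => hmin _ _ hlt hR) (not_lt.1 fun hlt => hz _ hlt (hf _))

theorem DefinableFun.definable₂_le (hf : DefinableFun f) : Definable₂ fun m x => m ≤ f x := by
  refine Definable.congr (P := fun x => ∀ l < x 0, ¬ f (x 1) = l) ?_ fun x => ?_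
  · repeat' first | apply hf.comp | constructor
  · exact ⟨fun h => not_lt.1 fun hlt => h _ hlt rfl, fun h l hl hfl => (h.trans_eq hfl).not_gt hl⟩

theorem DefinableFun.monotone_of_le_add_one (hf : DefinableFun f) (h : ∀ x, f x ≤ f (x + 1)) :
    Monotone f := by
  intro x y hxy
  obtain ⟨d, rfl⟩ := exists_add_of_le hxy
  clear hxy
  induction d using definable_induction with
  | definable => exact hf.definable₂_le.comp (.const _) (.add (.const x) (.var 0))
  | zero => rw [add_zero]
  | succ d ih => exact ih.trans (by simpa only [add_assoc] using h (x + d))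

theorem DefinableFun.exists_crossing (hf : DefinableFun f) {b t m : M.Num} (hbt : b ≤ t)
    (hb : f b ≤ m) (ht : m < f t) : ∃ y, b ≤ y ∧ y < t ∧ f y ≤ m ∧ m < f (y + 1) := by
  obtain ⟨z, ⟨hbz, hz⟩, hmin⟩ := exists_least (P := fun z => b ≤ z ∧ m + 1 ≤ f z)
    (.and (by repeat' constructor) (hf.definable₂_le.comp (.const _) (.var 0)))
    ⟨t, hbt, Order.add_one_le_of_lt ht⟩
  have hbz : b < z := hbz.lt_of_ne fun h => (h ▸ hz).not_gt (Order.lt_add_one_iff.2 hb)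
  obtain ⟨y, rfl⟩ := exists_add_of_le (Order.one_le_iff_pos.2 (zero_le.trans_lt hbz))
  rw [add_comm 1] at hbz hz hmin
  have hby : b ≤ y := Order.lt_add_one_iff.1 hbz
  have hyt : y + 1 ≤ t := not_lt.1 fun hlt => hmin t hlt ⟨hbt, Order.add_one_le_of_lt ht⟩
  exact ⟨y, hby, Order.add_one_le_iff.1 hyt,
    not_lt.1 fun hlt => hmin y (lt_add_one y) ⟨hby, Order.add_one_le_of_lt hlt⟩,
    Order.add_one_le_iff.1 hz⟩

end DefinableFun

section Coding

theorem definable₁_mem_univ : Definable₁ (· ∈ (Set.univ : Set M.Num)) :=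
  Definable.congr (P := fun x => x 0 = x 0) (.eq (.var 0) (.var 0)) fun x => by simp

theorem definable₁_mem_below (j : M.Num) : Definable₁ (· ∈ M.below j) :=
  .lt (.var 0) (.const j)

/-- The set of codes of the pairs `(x, f x)` with `x ∈ X`. -/
def graphOn (f : M.Num → M.Num) (X : Set M.Num) : Set M.Num :=
  (fun x => M.pair x (f x)) '' X

variable [hM : Fact M.RCA0Star] {f : M.Num → M.Num} {X Y F : Set M.Num}

theorem pair_mem_graphOn {x y : M.Num} : M.pair x y ∈ graphOn f X ↔ x ∈ X ∧ f x = y := by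
  simp only [graphOn, Set.mem_image, pair_inj]
  exact ⟨by rintro ⟨x, hx, rfl, rfl⟩; exact ⟨hx, rfl⟩, fun ⟨hx, h⟩ => ⟨x, hx, rfl, h⟩⟩

theorem graphOn_mem_sets (hf : DefinableFun f) (hX : Definable₁ (· ∈ X)) :
    graphOn f X ∈ M.sets := by
  have hgraph : Definable₁ fun z => ∃ x < z + 1, ∃ y < z + 1, z = M.pair x y ∧ x ∈ X ∧ f x = y := by
    repeat' first | apply hX.comp | apply hf.comp | constructor
  convert ofPred_mem_sets hgraph using 1
  ext z
  constructor
  · rintro ⟨x, hx, rfl⟩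
    exact ⟨x, Order.lt_add_one_iff.2 (left_le_pair _ _), f x,
      Order.lt_add_one_iff.2 (right_le_pair _ _), rfl, hx, rfl⟩
  · rintro ⟨x, -, _, -, rfl, hx, rfl⟩
    exact ⟨x, hx, rfl⟩

theorem isFun_graphOn (h : Set.MapsTo f X Y) : M.IsFun (graphOn f X) X Y := by
  refine ⟨?_, fun x hx => ⟨f x, pair_mem_graphOn.2 ⟨hx, rfl⟩, fun y hy => ?_⟩⟩
  · rintro _ ⟨x, hx, rfl⟩
    exact ⟨x, hx, f x, h hx, rfl⟩
  · exact (pair_mem_graphOn.1 hy).2.symm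

theorem IsFun.exists_eq_graphOn (hfun : M.IsFun F X Y) (hF : F ∈ M.sets)
    (hX : Definable₁ (· ∈ X)) :
    ∃ f, DefinableFun f ∧ Set.MapsTo f X Y ∧ F = graphOn f X := by
  have hR : Definable₂ fun x y => x ∈ X → M.pair x y ∈ F :=
    .imp (hX.comp (.var 0)) (.mem hF (by repeat' constructor))
  obtain ⟨f, hf, hfF, -⟩ := exists_definableFun_least hR fun x => by
    by_cases hx : x ∈ X
    · obtain ⟨y, hy, -⟩ := hfun.2 x hx
      exact ⟨y, fun _ => hy⟩
    · exact ⟨x, fun h => absurd h hx⟩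
  have hfY : Set.MapsTo f X Y := fun x hx => by
    obtain ⟨x', -, y, hy, hxy⟩ := hfun.1 _ (hfF x hx)
    rwa [(pair_inj.1 hxy).2]
  refine ⟨f, hf, hfY, Set.Subset.antisymm (fun z hz => ?_) ?_⟩
  · obtain ⟨x, hx, y, -, rfl⟩ := hfun.1 z hz
    exact pair_mem_graphOn.2 ⟨hx, (hfun.2 x hx).unique (hfF x hx) hz⟩
  · rintro _ ⟨x, hx, rfl⟩
    exact hfF x hx

theorem sameValue_graphOn_iff {x y : M.Num} (hx : x ∈ X) (hy : y ∈ X) :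
    M.SameValue (graphOn f X) x y ↔ f x = f y := by
  simp only [SameValue, pair_mem_graphOn, hx, hy, true_and]
  exact ⟨fun ⟨_, hx, hy⟩ => hx.trans hy.symm, fun h => ⟨f y, h, rfl⟩⟩

theorem forall_coloring_iff {k : M.Num} {Q : Set M.Num → Prop} :
    (∀ F ∈ M.sets, M.IsFun F Set.univ (M.below k) → Q F) ↔
      ∀ f, DefinableFun f → (∀ x, f x < k) → Q (graphOn f Set.univ) := by
  constructor
  · intro h f hf hk
    exact h _ (graphOn_mem_sets hf definable₁_mem_univ) (isFun_graphOn fun x _ => hk x)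
  · intro h F hF hfun
    obtain ⟨f, hf, hk, rfl⟩ := hfun.exists_eq_graphOn hF definable₁_mem_univ
    exact h f hf fun x => hk (Set.mem_univ x)

theorem ERT_iff : M.ERT ↔ ∀ k f, DefinableFun f → (∀ x : M.Num, f x < k) →
    ∃ b, ∀ x ≥ b, ∃ y ≥ b, x ≠ y ∧ f x = f y := by
  refine forall_congr' fun k => forall_coloring_iff.trans ?_
  simp only [sameValue_graphOn_iff (Set.mem_univ _) (Set.mem_univ _)]
  rfl

theorem occursAtLeast_graphOn_iff {b x j : M.Num} :
    M.OccursAtLeast (graphOn f Set.univ) b x j ↔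
      ∃ g, DefinableFun g ∧ StrictMonoOn g (Set.Iio j) ∧ ∀ i < j, b ≤ g i ∧ f (g i) = f x := by
  constructor
  · rintro ⟨G, hG, hfun, hmono, hval⟩
    obtain ⟨g, hg, -, rfl⟩ := hfun.exists_eq_graphOn hG (definable₁_mem_below j)
    have hpair {i : M.Num} (hi : i < j) : M.pair i (g i) ∈ graphOn g (M.below j) :=
      pair_mem_graphOn.2 ⟨hi, rfl⟩
    refine ⟨g, hg, fun i hi i' hi' hlt => hmono i i' _ _ hlt (hpair hi) (hpair hi'),
      fun i hi => (hval i _ (hpair hi)).imp_right fun h => ?_⟩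
    exact ((sameValue_graphOn_iff (Set.mem_univ _) (Set.mem_univ _)).1 h).symm
  · rintro ⟨g, hg, hmono, hval⟩
    refine ⟨_, graphOn_mem_sets hg (definable₁_mem_below j), isFun_graphOn (Set.mapsTo_univ _ _),
      fun i i' y y' hlt hy hy' => ?_, fun i y hy => ?_⟩
    · obtain ⟨hi, rfl⟩ := pair_mem_graphOn.1 hy
      obtain ⟨hi', rfl⟩ := pair_mem_graphOn.1 hy'
      exact hmono hi hi' hlt
    · obtain ⟨hi, rfl⟩ := pair_mem_graphOn.1 hy
      exact (hval i hi).imp_right fun h =>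
        (sameValue_graphOn_iff (Set.mem_univ _) (Set.mem_univ _)).2 h.symm

theorem ERTAt_iff {j : M.Num} : M.ERTAt j ↔ ∀ k f, DefinableFun f → (∀ x : M.Num, f x < k) →
    ∃ b, ∀ x ≥ b, ∃ g, DefinableFun g ∧ StrictMonoOn g (Set.Iio j) ∧
      ∀ i < j, b ≤ g i ∧ f (g i) = f x := by
  refine forall_congr' fun k => forall_coloring_iff.trans ?_
  simp only [occursAtLeast_graphOn_iff]
  rfl

end Coding

section ERT

variable [hM : Fact M.RCA0Star]

theorem ERT_of_ERTAt_two (h : M.ERTAt 2) : M.ERT := by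
  refine ERT_iff.2 fun k f hf hk => ?_
  obtain ⟨b, hb⟩ := ERTAt_iff.1 h k f hf hk
  refine ⟨b, fun x hx => ?_⟩
  obtain ⟨g, -, hmono, hg⟩ := hb x hx
  have hlt : g 0 < g 1 := hmono (Set.mem_Iio.2 two_pos) (Set.mem_Iio.2 one_lt_two) one_pos
  obtain ⟨h₀, hf₀⟩ := hg 0 two_pos
  obtain ⟨h₁, hf₁⟩ := hg 1 one_lt_two
  rcases eq_or_ne x (g 0) with rfl | hne
  · exact ⟨g 1, h₁, hlt.ne, hf₁.symm⟩
  · exact ⟨g 0, h₀, hne, hf₀.symm⟩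

theorem ERT.exists_forall_eq_of_monotone (hE : M.ERT) {h : M.Num → M.Num} (hh : DefinableFun h)
    (mono : Monotone h) {a : M.Num} (le : ∀ s, h s ≤ a) : ∃ b, ∀ s ≥ b, h s = h b := by
  classical
  -- Steps at which `h` increases receive the color `h s`, which is not used again: a color that
  -- occurs twice must be `a + 1`.
  let f (s : M.Num) : M.Num := if h s = h (s + 1) then a + 1 else h s
  have hf : DefinableFun f := by
    refine Definable.congr (P := fun x => ∃ l < a + 1, h (x 0) = l ∧
      ((h (x 0 + 1) = l ∧ a + 1 = x 1) ∨ (¬ h (x 0 + 1) = l ∧ l = x 1))) ?_ fun x => ?_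
    · repeat' first | apply hh.comp | constructor
    · have := le (x 0)
      grind [Order.lt_add_one_iff]
  obtain ⟨b, hb⟩ := ERT_iff.1 hE (a + 1 + 1) f hf fun s => by
    have := (le s).trans_lt (lt_add_one a)
    simp only [f]
    split_ifs
    exacts [lt_add_one _, this.trans (lt_add_one _)]
  have not_repeated {x y : M.Num} (hx : h x ≠ h (x + 1)) (hxy : x < y) : f x ≠ f y := by
    have h₁ : h x < h (x + 1) := (mono (lt_add_one x).le).lt_of_ne hx
    have h₂ : h (x + 1) ≤ h y := mono (Order.add_one_le_of_lt hxy)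
    have h₃ : h x < a + 1 := Order.lt_add_one_iff.2 (le x)
    grind
  have constant (s) (hs : b ≤ s) : h s = h (s + 1) := by
    by_contra hne
    obtain ⟨y, -, hsy, hfsy⟩ := hb s hs
    rcases hsy.lt_or_gt with hlt | hgt
    · exact not_repeated hne hlt hfsy
    · refine not_repeated (fun hy => ?_) hgt hfsy.symm
      have : h s < a + 1 := Order.lt_add_one_iff.2 (le s)
      grind
  refine ⟨b, fun s hs => ?_⟩
  obtain ⟨d, rfl⟩ := exists_add_of_le hs
  clear hs
  induction d using definable_induction with
  | definable => exact hh.comp (by repeat' constructor) (.const _)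
  | zero => rw [add_zero]
  | succ d ih => rw [← ih, ← add_assoc, ← constant (b + d) le_self_add]

theorem ISigma01_of_ERT (hE : M.ERT) : M.ISigma01 := by
  intro θ V v zero succ a
  by_contra ha
  let T (n x : M.Num) : Prop := M.Sat V (push x (push n v)) θ
  have hT : Definable₂ fun s n => ¬ ∃ x < s, T n x := by
    have := definable₂_sat V v θ
    repeat' first | apply this.comp | constructor
  obtain ⟨h, hh, hnot, hle⟩ := exists_definableFun_least hT fun s =>
    ⟨a, fun ⟨x, _, hx⟩ => ha ⟨x, hx⟩⟩
  have mono : Monotone h := fun s s' hs =>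
    hle s _ fun ⟨x, hx, hT⟩ => hnot s' ⟨x, hx.trans_le hs, hT⟩
  obtain ⟨b, hb⟩ := hE.exists_forall_eq_of_monotone hh mono fun s =>
    hle s a fun ⟨x, _, hx⟩ => ha ⟨x, hx⟩
  have : ∃ x, T (h b) x := by
    rcases eq_or_ne (h b) 0 with h0 | h0
    · exact h0 ▸ zero
    · obtain ⟨m, hm⟩ := exists_add_of_le (Order.one_le_iff_pos.2 (pos_iff_ne_zero.2 h0))
      rw [add_comm] at hm
      have : m < h b := hm ▸ lt_add_one m
      by_contra hT
      have : h b ≤ m := hle b m fun ⟨x, _, hx⟩ => hT (hm ▸ succ m ⟨x, hx⟩)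
      order
  obtain ⟨x, hx⟩ := this
  refine hnot (max b (x + 1)) ⟨x, (lt_add_one x).trans_le (le_max_right _ _), ?_⟩
  rwa [hb _ (le_max_left _ _)]

end ERT

section Digit

/-- `d` is the digit with index `i` in the base `B` expansion of `n`. The quantifiers are bounded so
that the relation is `Σ⁰₀`. -/
def IsDigit (B n i d : M.Num) : Prop :=
  d < B ∧ ∃ q < n + 1, ∃ r < B ^ i, n = (q * B + d) * B ^ i + r

theorem definable₄_isDigit : Definable₄ (IsDigit (M := M)) := by
  repeat' constructor

variable [hM : Fact M.RCA0Star] {B n m i d e : M.Num}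

theorem exists_eq_mul_add (hd : 0 < d) (n : M.Num) : ∃ q < n + 1, ∃ r < d, n = q * d + r := by
  induction n using definable_induction with
  | definable => repeat' constructor
  | zero => exact ⟨0, lt_add_one 0, 0, hd, by rw [zero_mul, zero_add]⟩
  | succ n ih =>
    obtain ⟨q, hq, r, hr, h⟩ := ih
    rcases (Order.add_one_le_of_lt hr).lt_or_eq with hr' | hr'
    · exact ⟨q, hq.trans (lt_add_one _), r + 1, hr', by rw [h, add_assoc]⟩
    · exact ⟨q + 1, add_lt_add_left hq 1, 0, hd, by rw [h, add_assoc, hr', add_one_mul, add_zero]⟩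

theorem mul_add_lt_mul {a b r d : M.Num} (ha : a < b) (hr : r < d) : a * d + r < b * d :=
  calc a * d + r < a * d + d := add_lt_add_right hr _
    _ = (a + 1) * d := (add_one_mul a d).symm
    _ ≤ b * d := mul_le_mul_left (Order.add_one_le_of_lt ha) d

theorem mul_add_inj {d q r q' r' : M.Num} (hr : r < d) (hr' : r' < d)
    (h : q * d + r = q' * d + r') : q = q' ∧ r = r' := by
  rcases lt_trichotomy q q' with hlt | rfl | hgt
  · exact absurd h ((mul_add_lt_mul hlt hr).trans_le le_self_add).ne
  · exact ⟨rfl, add_left_cancel h⟩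
  · exact absurd h ((mul_add_lt_mul hgt hr').trans_le le_self_add).ne'

theorem IsDigit.of_eq {q r : M.Num} (hd : d < B) (hr : r < B ^ i)
    (h : n = (q * B + d) * B ^ i + r) : IsDigit B n i d := by
  have hB : 0 < B := zero_le.trans_lt hd
  refine ⟨hd, q, Order.lt_add_one_iff.2 ?_, r, hr, h⟩
  calc q ≤ q * B := le_mul_of_one_le_right' (Order.one_le_iff_pos.2 hB)
    _ ≤ q * B + d := le_self_add
    _ ≤ (q * B + d) * B ^ i := le_mul_of_one_le_right' (Order.one_le_iff_pos.2 (exp_pos hB i))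
    _ ≤ n := h ▸ le_self_add

theorem IsDigit.unique (hd : IsDigit B n i d) (he : IsDigit B n i e) : d = e := by
  obtain ⟨hd, q, -, r, hr, h⟩ := hd
  obtain ⟨he, q', -, r', hr', h'⟩ := he
  exact (mul_add_inj hd he (mul_add_inj hr hr' (h.symm.trans h')).1).2

theorem exists_isDigit (hB : 0 < B) (n i : M.Num) : ∃ d < B, IsDigit B n i d := by
  obtain ⟨p, -, r, hr, rfl⟩ := exists_eq_mul_add (exp_pos hB i) n
  obtain ⟨q, -, d, hd, rfl⟩ := exists_eq_mul_add hB p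
  exact ⟨d, hd, .of_eq hd hr rfl⟩

theorem isDigit_zero (hB : 0 < B) (i : M.Num) : IsDigit B 0 i 0 :=
  .of_eq (q := 0) (r := 0) hB (exp_pos hB i) (by ring)

theorem add_mul_exp_lt (hn : n < B ^ m) (he : e < B) : n + e * B ^ m < B ^ (m + 1) := by
  rw [exp_add_one, add_comm, mul_comm (B ^ m)]
  exact mul_add_lt_mul he hn

theorem isDigit_add_mul_exp (hn : n < B ^ m) (he : e < B) : IsDigit B (n + e * B ^ m) m e :=
  .of_eq (q := 0) he hn (by ring)

theorem IsDigit.add_mul_exp (hd : IsDigit B n i d) (hi : i < m) (e : M.Num) :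
    IsDigit B (n + e * B ^ m) i d := by
  obtain ⟨hd, q, -, r, hr, rfl⟩ := hd
  obtain ⟨c, rfl⟩ := exists_add_of_le (Order.add_one_le_of_lt hi)
  refine .of_eq (q := q + e * B ^ c) hd hr ?_
  rw [exp_add, exp_add_one]
  ring

end Digit

section Path

/-- The base `B` digits of `n` with indices `0, …, m` form a sequence which starts with `0` and
whose successive entries are related by `S`. This is how finite sequences are coded by numbers. -/
def IsPath (S : M.Num → M.Num → M.Num → Prop) (B n m : M.Num) : Prop :=
  IsDigit B n 0 0 ∧ ∀ i < m, ∃ d < B, ∃ e < B, IsDigit B n i d ∧ IsDigit B n (i + 1) e ∧ S i d e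

theorem definable₄_isPath {S : M.Num → M.Num → M.Num → M.Num → Prop} (hS : Definable₄ S) :
    Definable₄ fun c B n m => IsPath (S c) B n m := by
  refine .and (definable₄_isDigit.comp (.var 1) (.var 2) (.const 0) (.const 0)) ?_
  repeat' first | apply definable₄_isDigit.comp | apply hS.comp | constructor

variable [hM : Fact M.RCA0Star] {B m : M.Num}

theorem exists_isPath {S : M.Num → M.Num → M.Num → Prop} (hS : Definable₃ S) (hB : 0 < B)
    (h : ∀ i < m, ∀ d < B, ∃ e < B, S i d e) : ∃ n < B ^ (m + 1), IsPath S B n m := by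
  suffices key : ∀ l, l < m + 1 → ∃ n < B ^ (l + 1), IsPath S B n l from key m (lt_add_one m)
  intro l
  induction l using definable_induction with
  | definable =>
    have := definable₄_isPath (S := fun _ => S) (hS.comp (.var 1) (.var 2) (.var 3))
    repeat' first | apply this.comp (.const 0) | constructor
  | zero => exact fun _ => ⟨0, exp_pos hB _, isDigit_zero hB 0, fun i hi => absurd hi not_lt_zero⟩
  | succ l ih =>
    intro hl
    have hlm : l < m := lt_of_add_lt_add_right hl
    obtain ⟨n, hn, hzero, hstep⟩ := ih (hlm.trans (lt_add_one m))
    obtain ⟨d, hdB, hd⟩ := exists_isDigit hB n l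
    obtain ⟨e, heB, he⟩ := h l hlm d hdB
    refine ⟨n + e * B ^ (l + 1), add_mul_exp_lt hn heB,
      hzero.add_mul_exp (zero_le.trans_lt (lt_add_one l)) e, fun i hi => ?_⟩
    rcases (Order.lt_add_one_iff.1 hi).lt_or_eq with hil | rfl
    · obtain ⟨d', hd'B, e', he'B, hd', he', hS⟩ := hstep i hil
      exact ⟨d', hd'B, e', he'B, hd'.add_mul_exp hi e,
        he'.add_mul_exp (add_lt_add_left hil 1) e, hS⟩
    · exact ⟨d, hdB, e, heB, hd.add_mul_exp (lt_add_one i) e, isDigit_add_mul_exp hn heB, he⟩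

variable {F : M.Num → M.Num → M.Num}

theorem IsPath.exists_common_digit (hF : ∀ i, ∀ d ≤ i, F i d ≤ i + 1) {B' n n' m' : M.Num}
    (h : IsPath (fun i d e => d ≤ i → F i d = e) B n m)
    (h' : IsPath (fun i d e => d ≤ i → F i d = e) B' n' m') {i : M.Num}
    (hi : i ≤ m) (hi' : i ≤ m') :
    ∃ d < i + 1, IsDigit B n i d ∧ IsDigit B' n' i d := by
  induction i using definable_induction with
  | definable => repeat' first | apply definable₄_isDigit.comp | constructor
  | zero => exact ⟨0, lt_add_one 0, h.1, h'.1⟩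
  | succ i ih =>
    obtain ⟨d, hdi, hd, hd'⟩ := ih ((lt_add_one i).le.trans hi) ((lt_add_one i).le.trans hi')
    obtain ⟨a, -, e, -, ha, he, hae⟩ := h.2 i (Order.add_one_le_iff.1 hi)
    obtain ⟨a', -, e', -, ha', he', hae'⟩ := h'.2 i (Order.add_one_le_iff.1 hi')
    have hdi : d ≤ i := Order.lt_add_one_iff.1 hdi
    obtain rfl := ha.unique hd
    obtain rfl := ha'.unique hd'
    obtain rfl := hae hdi
    exact ⟨_, Order.lt_add_one_iff.2 (hF i _ hdi), he, hae' hdi ▸ he'⟩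

theorem exists_isPath_of_le_add_one (definable : Definable₃ fun i d e => F i d = e)
    (hF : ∀ i, ∀ d ≤ i, F i d ≤ i + 1) (m : M.Num) :
    ∃ n < (m + 1) ^ (m + 1), IsPath (fun i d e => d ≤ i → F i d = e) (m + 1) n m := by
  have hS : Definable₃ fun i d e => d ≤ i → F i d = e := by
    repeat' first | apply definable.comp | constructor
  refine exists_isPath hS (zero_le.trans_lt (lt_add_one m)) fun i hi d hd => ?_
  by_cases hdi : d ≤ i
  · exact ⟨_, (hF i d hdi).trans_lt (add_lt_add_left hi 1), fun _ => rfl⟩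
  · exact ⟨d, hd, fun h => absurd h hdi⟩

theorem exists_definable_rec {F : M.Num → M.Num → M.Num → M.Num}
    (definable : Definable₄ fun c i d e => F c i d = e) (hF : ∀ c i, ∀ d ≤ i, F c i d ≤ i + 1) :
    ∃ h : M.Num → M.Num → M.Num, Definable₃ (fun c i d => h c i = d) ∧
      (∀ c i, h c i ≤ i) ∧ (∀ c, h c 0 = 0) ∧ ∀ c i, h c (i + 1) = F c i (h c i) := by
  have path (c m : M.Num) := exists_isPath_of_le_add_one
    (definable.comp (.const c) (.var 0) (.var 1) (.var 2)) (hF c) m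
  choose n hn hpath using path
  have digit (c i : M.Num) : ∃ d ≤ i, ∀ m ≥ i, IsDigit (m + 1) (n c m) i d := by
    obtain ⟨d, hdi, hd, -⟩ := (hpath c i).exists_common_digit (hF c) (hpath c i) le_rfl le_rfl
    refine ⟨d, Order.lt_add_one_iff.1 hdi, fun m hm => ?_⟩
    obtain ⟨d', -, hd₁, hd₂⟩ := (hpath c i).exists_common_digit (hF c) (hpath c m) le_rfl hm
    exact hd.unique hd₁ ▸ hd₂
  choose h hle hdigit using digit
  refine ⟨h, ?_, hle, fun c => le_zero_iff.1 (hle c 0), fun c i => ?_⟩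
  · refine Definable.congr (P := fun x => ∃ p < (x 1 + 1) ^ (x 1 + 1),
      IsPath (fun i d e => d ≤ i → F (x 0) i d = e) (x 1 + 1) p (x 1) ∧
        IsDigit (x 1 + 1) p (x 1) (x 2)) ?_ fun x => ⟨?_, ?_⟩
    · have := definable₄_isPath (S := fun c i d e => d ≤ i → F c i d = e)
        (by repeat' first | apply definable.comp | constructor)
      repeat' first | apply definable₄_isDigit.comp | apply this.comp | constructor
    · rintro ⟨p, -, hp, hd⟩
      obtain ⟨d, -, hd₁, hd₂⟩ := (hpath (x 0) (x 1)).exists_common_digit (hF _) hp le_rfl le_rfl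
      rw [(hdigit _ _ _ le_rfl).unique hd₁, hd₂.unique hd]
    · exact fun hd => ⟨_, hn _ _, hpath _ _, hd ▸ hdigit _ _ _ le_rfl⟩
  · obtain ⟨d, -, e, -, hd, he, hS⟩ := (hpath c (i + 1)).2 i (lt_add_one i)
    obtain rfl := hd.unique (hdigit c i _ (lt_add_one i).le)
    rw [hS (hle c i), he.unique (hdigit c (i + 1) _ le_rfl)]

end Path

section Count

/-- `N s` is the number of elements of `{y | A y}` below `s`. -/
structure IsCount (A : M.Num → Prop) (N : M.Num → M.Num) : Prop where
  definableFun : DefinableFun N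
  zero : N 0 = 0
  add_one_of : ∀ s, A s → N (s + 1) = N s + 1
  add_one_of_not : ∀ s, ¬ A s → N (s + 1) = N s

variable [hM : Fact M.RCA0Star]

theorem exists_isCount {A : M.Num → M.Num → Prop} (hA : Definable₂ A) :
    ∃ N : M.Num → M.Num → M.Num, Definable₃ (fun c s m => N c s = m) ∧
      (∀ c s, N c s ≤ s) ∧ ∀ c, IsCount (A c) (N c) := by
  classical
  let F (c s m : M.Num) : M.Num := if A c s then m + 1 else m
  have hF : Definable₄ fun c s m l => F c s m = l := by
    refine Definable.congr (P := fun x => (A (x 0) (x 1) ∧ x 2 + 1 = x 3) ∨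
      (¬ A (x 0) (x 1) ∧ x 2 = x 3)) ?_ fun x => ?_
    · repeat' first | apply hA.comp | constructor
    · grind
  obtain ⟨N, hN, hle, hzero, hsucc⟩ := exists_definable_rec hF fun c s m hm => by
    have : m + 1 ≤ s + 1 := add_le_add_left hm 1
    simp only [F]
    split_ifs
    exacts [this, (lt_add_one m).le.trans this]
  refine ⟨N, hN, hle, fun c => ⟨hN.comp (.const c) (.var 0) (.var 1), hzero c, fun s hs => ?_,
    fun s hs => ?_⟩⟩
  · exact (hsucc c s).trans (if_pos hs)
  · exact (hsucc c s).trans (if_neg hs)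

variable {A A' : M.Num → Prop} {N N' : M.Num → M.Num}

theorem IsCount.monotone (h : IsCount A N) : Monotone N := by
  refine h.definableFun.monotone_of_le_add_one fun s => ?_
  by_cases hs : A s
  · exact h.add_one_of s hs ▸ le_self_add
  · exact (h.add_one_of_not s hs).ge

theorem IsCount.lt_of_lt (h : IsCount A N) {s t : M.Num} (hst : s < t) (hs : A s) : N s < N t :=
  calc N s < N s + 1 := lt_add_one _
    _ = N (s + 1) := (h.add_one_of s hs).symm
    _ ≤ N t := h.monotone (Order.add_one_le_of_lt hst)

theorem IsCount.add_le_of_imp (h : IsCount A N) (h' : IsCount A' N') (himp : ∀ s, A s → A' s)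
    {s t e : M.Num} (hst : s ≤ t) (hs : N s + e ≤ N' s) : N t + e ≤ N' t := by
  suffices key : ∀ d, ∀ l < N t + 1, N (s + d) = l → l + e ≤ N' (s + d) by
    obtain ⟨d, rfl⟩ := exists_add_of_le hst
    exact key d _ (lt_add_one _) rfl
  intro d
  induction d using definable_induction with
  | definable =>
    have hN := h.definableFun
    have hle := h'.definableFun.definable₂_le
    repeat' first | apply hN.comp | apply hle.comp | constructor
  | zero => rintro _ - rfl; rwa [add_zero]
  | succ d ih =>
    rintro _ hl rfl
    rw [← add_assoc] at hl ⊢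
    have ih : N (s + d) + e ≤ N' (s + d) :=
      ih _ ((h.monotone (lt_add_one _).le).trans_lt hl) rfl
    by_cases hA : A (s + d)
    · rw [h.add_one_of _ hA, h'.add_one_of _ (himp _ hA), add_right_comm]
      exact add_le_add_left ih 1
    · rw [h.add_one_of_not _ hA]
      exact ih.trans (h'.monotone (lt_add_one _).le)

theorem IsCount.exists_enumeration (h : IsCount A N) (hA : Definable₁ A) {b t j : M.Num}
    (ht : N b + j ≤ N t) : ∃ g, DefinableFun g ∧ StrictMonoOn g (Set.Iio j) ∧
      ∀ i < j, b ≤ g i ∧ A (g i) := by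
  have hR : Definable₂ fun i y => i < j → b ≤ y ∧ A y ∧ N y = N b + i := by
    have := h.definableFun
    repeat' first | apply hA.comp | apply this.comp | constructor
  obtain ⟨g, hg, hgR, -⟩ := exists_definableFun_least hR fun i => by
    by_cases hi : i < j
    · have hit : N b + i < N t := (add_lt_add_right hi _).trans_le ht
      have hbt : b ≤ t := not_lt.1 fun hlt =>
        (le_self_add.trans_lt hit).not_ge (h.monotone hlt.le)
      obtain ⟨y, hby, -, hy, hy'⟩ := h.definableFun.exists_crossing hbt le_self_add hit
      have hAy : A y := by
        by_contra hAy
        exact (h.add_one_of_not y hAy ▸ hy').not_ge hy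
      rw [h.add_one_of y hAy] at hy'
      exact ⟨y, fun _ => ⟨hby, hAy, hy.antisymm (Order.lt_add_one_iff.1 hy')⟩⟩
    · exact ⟨i, fun h => absurd h hi⟩
  refine ⟨g, hg, fun i hi i' hi' hlt => h.monotone.reflect_lt ?_, fun i hi =>
    ⟨(hgR i hi).1, (hgR i hi).2.1⟩⟩
  rw [(hgR i hi).2.2, (hgR i' hi').2.2]
  exact add_lt_add_right hlt _

end Count

section Collection

variable [hM : Fact M.RCA0Star]

theorem ISigma01.strong_collection (hI : M.ISigma01) {R : M.Num → M.Num → Prop}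
    (hR : Definable₂ R) (m : M.Num) : ∃ t, ∀ i < m, ∀ s, R i s → ∃ s' < t, R i s' := by
  -- If not, then the number `N t m` of `i < m` with a witness below `t` is unbounded.
  by_contra! hne
  obtain ⟨N, hN, hle, hcount⟩ := exists_isCount (A := fun t i => ∃ s < t, R i s)
    (by repeat' first | apply hR.comp | constructor)
  have hdef : Definable₂ fun n t => ∃ l < m + 1, N t m = l ∧ n ≤ l := by
    repeat' first | apply hN.comp | constructor
  suffices hunbounded : ∀ n, ∃ t, ∃ l < m + 1, N t m = l ∧ n ≤ l by
    obtain ⟨_, l, hl, -, hml⟩ := hunbounded (m + 1)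
    exact hl.not_ge hml
  refine hI.induction hdef ⟨0, _, Order.lt_add_one_iff.2 (hle 0 m), rfl, zero_le⟩ ?_
  rintro n ⟨t, _, -, rfl, hn⟩
  obtain ⟨i, hi, s, hs, hnot⟩ := hne t
  have hnot' : ¬ ∃ s < t, R i s := fun ⟨s, hst, hs⟩ => hnot s hst hs
  have hsub (x : M.Num) : (∃ s < t, R x s) → ∃ s' < max t (s + 1), R x s' := fun ⟨s', hs', hx⟩ =>
    ⟨s', hs'.trans_le (le_max_left _ _), hx⟩
  have hle_i : N t i ≤ N (max t (s + 1)) i := by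
    have h0 : N t 0 + 0 ≤ N (max t (s + 1)) 0 := by rw [(hcount _).zero, add_zero]; exact zero_le
    simpa only [add_zero] using (hcount _).add_le_of_imp (hcount _) hsub zero_le h0
  have hlt : N t m + 1 ≤ N (max t (s + 1)) m := by
    refine (hcount _).add_le_of_imp (hcount _) hsub (Order.add_one_le_of_lt hi) ?_
    rw [(hcount _).add_one_of_not i hnot',
      (hcount _).add_one_of i ⟨s, (lt_add_one s).trans_le (le_max_right _ _), hs⟩]
    exact add_le_add_left hle_i 1
  exact ⟨_, _, Order.lt_add_one_iff.2 (hle _ m), rfl, (add_le_add_left hn 1).trans hlt⟩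

theorem ISigma01.exists_forall_lt_add_le (hI : M.ISigma01) {N : M.Num → M.Num → M.Num}
    (hN : Definable₃ fun c s m => N c s = m) (hle : ∀ c s, N c s ≤ s) (j k : M.Num) :
    ∃ t₀, ∀ t, ∃ b < t₀, ∀ c < k, N c b < N c t → N c b + j ≤ N c t := by
  rcases eq_zero_or_pos j with rfl | hj
  · exact ⟨1, fun t => ⟨0, one_pos, fun c _ hlt => (add_zero (N c 0)).trans_le hlt.le⟩⟩
  have hS : Definable₄ fun s c (_ : M.Num) d => ∃ q < s + 1, N c s = q * j + d := by
    repeat' first | apply hN.comp | constructor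
  have hresidue (s c : M.Num) : ∃ d < j, ∃ q < s + 1, N c s = q * j + d := by
    obtain ⟨q, hq, d, hd, h⟩ := exists_eq_mul_add hj (N c s)
    exact ⟨d, hd, q, hq.trans_le (add_le_add_left (hle c s) 1), h⟩
  let V (p s : M.Num) : Prop := IsPath (fun c _ d => ∃ q < s + 1, N c s = q * j + d) j p k
  have hV : Definable₂ V := (definable₄_isPath hS).comp (.var 1) (.const j) (.var 0) (.const k)
  obtain ⟨t₀, ht₀⟩ := hI.strong_collection hV (j ^ (k + 1))
  refine ⟨t₀, fun t => ?_⟩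
  obtain ⟨p, hp, hpt⟩ : ∃ p < j ^ (k + 1), V p t :=
    exists_isPath (hS.comp (.const t) (.var 0) (.var 1) (.var 2)) hj fun c _ _ _ => hresidue t c
  obtain ⟨b, hb, hpb⟩ := ht₀ p hp t hpt
  refine ⟨b, hb, fun c hc hlt => ?_⟩
  obtain ⟨_, -, d, -, -, hd, q, -, hq⟩ := hpb.2 c hc
  obtain ⟨_, -, d', -, -, hd', q', -, hq'⟩ := hpt.2 c hc
  obtain rfl := hd.unique hd'
  rw [hq, hq'] at hlt ⊢
  have hqq' : q < q' := lt_of_mul_lt_mul_right' (lt_of_add_lt_add_right hlt)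
  calc q * j + d + j = (q + 1) * j + d := by ring
    _ ≤ q' * j + d := add_le_add_left (mul_le_mul_left (Order.add_one_le_of_lt hqq') j) d

theorem ERTAt_of_ISigma01 (hI : M.ISigma01) (j : M.Num) : M.ERTAt j := by
  refine ERTAt_iff.2 fun k f hf hk => ?_
  have hA : Definable₂ fun c s => f s = c := hf.comp (.var 1) (.var 0)
  obtain ⟨N, hN, hle, hcount⟩ := exists_isCount hA
  obtain ⟨t₀, ht₀⟩ := hI.exists_forall_lt_add_le hN hle j k
  obtain ⟨t, ht⟩ := hI.strong_collection (R := fun c s => t₀ ≤ s ∧ f s = c)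
    (.and (by repeat' constructor) hA) k
  obtain ⟨b, hb, hbt⟩ := ht₀ (max t t₀)
  refine ⟨b, fun x hx => ?_⟩
  obtain ⟨s, hbs, hst, hs⟩ : ∃ s ≥ b, s < max t t₀ ∧ f s = f x := by
    rcases lt_or_ge x t₀ with hlt | hge
    · exact ⟨x, hx, lt_max_of_lt_right hlt, rfl⟩
    · obtain ⟨s, hst, hs, hfs⟩ := ht (f x) (hk x) x ⟨hge, rfl⟩
      exact ⟨s, hb.le.trans hs, lt_max_of_lt_left hst, hfs⟩
  have hlt : N (f x) b < N (f x) (max t t₀) :=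
    ((hcount _).monotone hbs).trans_lt ((hcount _).lt_of_lt hst hs)
  exact (hcount (f x)).exists_enumeration (hA.comp (.const _) (.var 0)) (hbt _ (hk x) hlt)

end Collection

end Model

end SecondOrderArith

theorem mainTheorem1 (M : SecondOrderArith.Model) (hM : M.RCA0Star) :
    List.TFAE [M.ISigma01, M.ERT, ∀ j : M.Num, M.ERTAt j] := by
  have : Fact M.RCA0Star := ⟨hM⟩
  tfae_have 1 → 3 := SecondOrderArith.Model.ERTAt_of_ISigma01
  tfae_have 3 → 2 := fun h => SecondOrderArith.Model.ERT_of_ERTAt_two (h 2)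
  tfae_have 2 → 1 := SecondOrderArith.Model.ISigma01_of_ERT
  tfae_finish
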